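/- Let $n\ge 1$, let the cake be $[0,1]$ and let $N=\{1,\dots,n\}$ be the set of agents. A cut-set is a point $x$ of the simplex $\Delta^{n-1}=\{x\in\mathbb R^n: x_k\ge 0,\ \sum_k x_k=1\}$; its $k$-th piece is the interval $\bigl[\sum_{j<k}x_j,\ x_k+\sum_{j<k}x_j\bigr]$. An instance with global valuations consists of continuous functions $v_i:\Delta^{n-1}\to\mathbb R$ ($i\in N$) with $v_i(x)=0$ whenever $x_i=0$, where agent $i$ receives the $i$-th piece. It is nonnegative if $v_i(x)\ge 0$ for all $i$ and $x$. (1) Every nonnegative instance admits a connected equitable division, i.e. there is $x\in\Delta^{n-1}$ with $v_1(x)=v_2(x)=\dots=v_n(x)$. (2) Hence, for nonnegative valuations, every ordering $\sigma$ of the agents (a permutation of $N$, where $\sigma(k)$ is the agent who receives the $k$-th piece from the left) admits a connected equitable division that gives out the pieces in that order. That is, for every permutation $\sigma$: (a) for every nonnegative instance $(v_i)$ there is a cut-set $x$ such that all the numbers $v_i(y)$, $i\in N$, are equal, where $y_i=x_{\sigma^{-1}(i)}$ is the length of the piece of agent $i$; (b) if the agents have nonnegative values $v_i(\tau,x)$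 for all connected divisions, given by an ordering $\tau$ and a cut-set $x$, which are continuous in $x$ for each $\tau$ and are $0$ whenever the piece of agent $i$ has length $0$, then there is a cut-set $x$ such that all the numbers $v_i(\sigma,x)$, $i\in N$, are equal; (c) if the agents have local valuations, that is, $v_i([a,b])$ depends only on the interval received, is continuous in $(a,b)$ for $0\le a\le b\le 1$, is nonnegative, and is $0$ if $a=b$, then there is a cut-set $x$ such that all the numbers $v_i(A_i)$, $i\in N$, are equal, where $A_i$ is the $\sigma^{-1}(i)$-th piece of $x$. -/

import Mathlib

namespace CakeCutting

/-- A cut-set of the cake `[0,1]` into `n` pieces: `x k` is the length of the `k`-th piece from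
the left. -/
abbrev CutSet (n : ℕ) : Type := stdSimplex ℝ (Fin n)

/-- Left endpoint of the `k`-th piece from the left. -/
def leftEnd {n : ℕ} (x : CutSet n) (k : Fin n) : ℝ := ∑ j ∈ Finset.Iio k, x j

/-- Right endpoint of the `k`-th piece from the left. -/
def rightEnd {n : ℕ} (x : CutSet n) (k : Fin n) : ℝ := x k + ∑ j ∈ Finset.Iio k, x j

/-- A connected fair division instance with global valuations, where agent `i` receives the `i`-th
piece from the left. -/
structure Instance (n : ℕ) where
  /-- `val i x` is the value of agent `i` for the cut-set `x`. -/
  val : Fin n → CutSet n → ℝ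
  continuous_val : ∀ i, Continuous (val i)
  val_eq_zero : ∀ i (x : CutSet n), x i = 0 → val i x = 0

/-- All valuation functions are nonnegative. -/
def Instance.Nonneg {n : ℕ} (I : Instance n) : Prop := ∀ i x, 0 ≤ I.val i x

/-- All agents have the same value for the cut-set `x`. -/
def Instance.IsEquitable {n : ℕ} (I : Instance n) (x : CutSet n) : Prop :=
  ∀ i j, I.val i x = I.val j x

/-- A connected division together with the left-to-right order in which its pieces are given to
the agents. -/
structure ConnectedDivision (n : ℕ) where
  /-- `order k` is the agent who receives the `k`-th piece from the left. -/
  order : Equiv.Perm (Fin n)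
  /-- The cut-set. -/
  cut : CutSet n

namespace ConnectedDivision

variable {n : ℕ}

/-- The length of the piece of each agent (indexed by agents, not by positions); this is again a
point of the simplex. -/
def shares (D : ConnectedDivision n) : CutSet n :=
  ⟨fun i => D.cut (D.order.symm i),
    fun i => D.cut.2.1 (D.order.symm i),
    (Equiv.sum_comp D.order.symm (fun k => D.cut k)).trans D.cut.2.2⟩

/-- Left endpoint of the piece of agent `i`. -/
def left (D : ConnectedDivision n) (i : Fin n) : ℝ := leftEnd D.cut (D.order.symm i)

/-- Right endpoint of the piece of agent `i`. -/
def right (D : ConnectedDivision n) (i : Fin n) : ℝ := rightEnd D.cut (D.order.symm i)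

end ConnectedDivision

/-- Global valuations of all connected divisions, with no order of the agents fixed: the value of
an agent may depend on all the cuts and also on who receives which piece. For each fixed order it
is continuous in the cut-set, and an agent with an empty piece has value `0`. -/
structure GlobalProfile (n : ℕ) where
  /-- `val i D` is the value of agent `i` for the division `D`. -/
  val : Fin n → ConnectedDivision n → ℝ
  continuous_val : ∀ i (σ : Equiv.Perm (Fin n)), Continuous fun x : CutSet n => val i ⟨σ, x⟩
  val_eq_zero : ∀ i (D : ConnectedDivision n), D.shares i = 0 → val i D = 0

/-- All valuation functions are nonnegative. -/
def GlobalProfile.Nonneg {n : ℕ} (P : GlobalProfile n) : Prop := ∀ i D, 0 ≤ P.val i D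

/-- All agents have the same value for the division `D`. -/
def GlobalProfile.IsEquitable {n : ℕ} (P : GlobalProfile n) (D : ConnectedDivision n) : Prop :=
  ∀ i j, P.val i D = P.val j D

/-- The pairs of endpoints of subintervals of `[0,1]`. -/
def intervals : Set (ℝ × ℝ) := {p | 0 ≤ p.1 ∧ p.1 ≤ p.2 ∧ p.2 ≤ 1}

/-- Local valuations: the value of an agent depends only on the interval it receives. Only the
values of `val i` on `intervals` matter. -/
structure LocalProfile (n : ℕ) where
  /-- `val i (a, b)` is the value of agent `i` for the interval `[a, b]`. -/
  val : Fin n → ℝ × ℝ → ℝ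
  continuousOn_val : ∀ i, ContinuousOn (val i) intervals
  val_eq_zero : ∀ i, ∀ a ∈ Set.Icc (0 : ℝ) 1, val i (a, a) = 0

/-- All valuation functions are nonnegative. -/
def LocalProfile.Nonneg {n : ℕ} (L : LocalProfile n) : Prop := ∀ i, ∀ p ∈ intervals, 0 ≤ L.val i p

/-- All agents have the same value for their own piece. -/
def LocalProfile.IsEquitable {n : ℕ} (L : LocalProfile n) (D : ConnectedDivision n) : Prop :=
  ∀ i j, L.val i (D.left i, D.right i) = L.val j (D.left j, D.right j)

end CakeCutting

/-! Colour each cut-set by an agent whose value there is least. On a fine finite net of the simplex,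
order the points by each coordinate, breaking ties. Scarf's lemma (`Scarf.exists_dominant_image_eq`)
then gives a dominant pair `(σ, C)` in which the colours on `σ` are exactly `C`. Dominance forces
the minima over `σ` of the coordinates in `C` to sum to almost 1, so the points of `σ` are close
together and their coordinates outside `C` are small (`exists_close_points`).

At any of these points, each agent of `C` has nearly the least value, because it has the least value
at a nearby point. Each agent outside `C` has a tiny piece, hence a value near 0, which by
nonnegativity is also nearly least. So all values nearly agree, and compactness yields exact
equality. No boundary condition on the colouring is needed.

Scarf's lemma is a parity argument: coloured doors and rooms are counted in incident pairs. Every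
door with points lies in two rooms, the one empty coloured door lies in one room, and a room that is
not fully coloured has an even number of coloured doors. -/

namespace Scarf

open Finset

/-! ### Scarf's lemma by double counting of rooms and doors -/

/-- A map from `s` onto a set with one element less identifies exactly one pair, whose members are
the only elements that can be dropped without losing surjectivity. -/
theorem exists_pair_of_card_eq_succ {α β : Type*} [DecidableEq α] [DecidableEq β]
    {s : Finset α} {t : Finset β} {c : α → β} (hcard : #s = #t + 1) (him : s.image c = t) :
    ∃ a ∈ s, ∃ b ∈ s, a ≠ b ∧ c a = c b ∧
      ∀ x ∈ s, (s.erase x).image c = t ↔ x = a ∨ x = b := by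
  obtain ⟨a, ha, b, hb, hab, hc⟩ := exists_ne_map_eq_of_card_lt_of_maps_to
    (s := s) (t := t) (f := c) (by omega) (fun x hx => by
      rw [← him]; exact mem_coe.2 (mem_image_of_mem c hx))
  refine ⟨a, ha, b, hb, hab, hc, fun x hx => ⟨fun h => ?_, fun h => ?_⟩⟩
  · by_contra! hne
    have hinj : Set.InjOn c (s.erase x : Finset α) := by
      rw [← card_image_iff, h, card_erase_of_mem hx]; omega
    exact hab (hinj (by simp [ha, hne.1.symm]) (by simp [hb, hne.2.symm]) hc)
  · apply Subset.antisymm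
    · rw [← him]; exact image_subset_image (erase_subset _ _)
    · intro y hy
      rw [← him] at hy
      obtain ⟨z, hz, rfl⟩ := mem_image.1 hy
      rw [mem_image]
      by_cases hzx : z = x
      · rcases h with rfl | rfl
        · exact ⟨b, by simp [hb, hab.symm], by rw [hzx, hc]⟩
        · exact ⟨a, by simp [ha, hab], by rw [hzx, hc]⟩
      · exact ⟨z, by simp [hz, hzx], rfl⟩

variable {T I α : Type*} [LinearOrder α]

/-- No point lies strictly above all of the `σ`-minima of the orders in `C`. -/
def Dominant (f : I → T → α) (σ : Finset T) (C : Finset I) : Prop :=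
  ∀ y, ∃ i ∈ C, ∀ x ∈ σ, f i y ≤ f i x

/-- A dominant pair of sets of the same size. -/
def IsRoom (f : I → T → α) (r : Finset T × Finset I) : Prop :=
  Dominant f r.1 r.2 ∧ #r.1 = #r.2

/-- A dominant pair with one order more than points. -/
def IsDoor (f : I → T → α) (d : Finset T × Finset I) : Prop :=
  Dominant f d.1 d.2 ∧ #d.2 = #d.1 + 1

/-- The door `d` belongs to the room `r`. -/
def Incident (r d : Finset T × Finset I) : Prop := d.1 ⊆ r.1 ∧ r.2 ⊆ d.2

theorem Dominant.mono {f : I → T → α} {σ τ : Finset T} {C D : Finset I} (h : Dominant f σ C)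
    (hτ : τ ⊆ σ) (hC : C ⊆ D) : Dominant f τ D := fun y =>
  let ⟨i, hi, hy⟩ := h y
  ⟨i, hC hi, fun x hx => hy x (hτ hx)⟩

theorem exists_minimizer (f : I → T → α) {σ : Finset T} (hσ : σ.Nonempty) :
    ∃ m : I → T, ∀ i, m i ∈ σ ∧ ∀ x ∈ σ, f i (m i) ≤ f i x := by
  choose m hm using fun i => exists_min_image σ (f i) hσ
  exact ⟨m, hm⟩

/-- Dominance tested at a point of `σ` itself makes that point the minimum of some order in `C`. So
the minimizer map is a bijection for a room and has exactly one coincidence for a door. -/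
theorem Dominant.image_minimizer [DecidableEq T] {f : I → T → α} (hf : ∀ i, Function.Injective (f i))
    {σ : Finset T} {C : Finset I} (h : Dominant f σ C) {m : I → T}
    (hm : ∀ i, m i ∈ σ ∧ ∀ x ∈ σ, f i (m i) ≤ f i x) : C.image m = σ := by
  apply Subset.antisymm
  · intro y hy
    obtain ⟨i, -, rfl⟩ := mem_image.1 hy
    exact (hm i).1
  · intro y hy
    obtain ⟨i, hi, hyi⟩ := h y
    exact mem_image.2 ⟨i, hi, hf i (le_antisymm ((hm i).2 y hy) (hyi _ (hm i).1))⟩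

variable [DecidableEq T] [DecidableEq I]

theorem incident_cases {f : I → T → α} {r d : Finset T × Finset I} (hr : IsRoom f r)
    (hd : IsDoor f d) (h : Incident r d) :
    (∃ k ∈ d.2, r = (d.1, d.2.erase k)) ∨ ∃ x ∉ d.1, r = (insert x d.1, d.2) := by
  obtain ⟨σ, C⟩ := r
  obtain ⟨τ, D⟩ := d
  have h1 := hr.2
  have h2 := hd.2
  obtain ⟨h3, h4⟩ := h
  simp only at h1 h2 h3 h4 ⊢
  have h5 := card_le_card h3
  have h6 := card_le_card h4
  by_cases hc : #C = #D
  · right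
    have hCD := eq_of_subset_of_card_le h4 hc.ge
    obtain ⟨x, hx, hxσ⟩ := (covBy_iff_exists_insert.1 (covBy_iff_card_sdiff_eq_one.2
      ⟨h3, by rw [card_sdiff_of_subset h3]; omega⟩))
    exact ⟨x, hx, by rw [hxσ, hCD]⟩
  · left
    have hτσ := eq_of_subset_of_card_le h3 (by omega)
    obtain ⟨x, hx, hxσ⟩ := (covBy_iff_exists_insert.1 (covBy_iff_card_sdiff_eq_one.2
      ⟨h4, by rw [card_sdiff_of_subset h4]; omega⟩))
    exact ⟨x, by rw [← hxσ]; simp, by rw [hτσ, ← hxσ, erase_insert hx]⟩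

/-- The room entered through the door `(τ, D)` by giving up the minimum of the order `k`. -/
def EnteredAt (f : I → T → α) (τ : Finset T) (D : Finset I) (k : I) (r : Finset T × Finset I) :
    Prop :=
  r = (τ, D.erase k) ∨
    ∃ x ∉ τ, r = (insert x τ, D) ∧ ∀ l ∈ D.erase k, ∃ z ∈ τ, f l z < f l x

/-- Since `k` and `k'` share their minimum, `k` can be freed. Either the other orders already
dominate, and `k` is dropped, or the points above all their minima have a unique `f k`-largest
member, which is the only one that can be inserted. -/
theorem existsUnique_enteredAt [Finite T] {f : I → T → α} (hf : ∀ i, Function.Injective (f i))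
    {τ : Finset T} {D : Finset I} (hd : IsDoor f (τ, D)) {m : I → T}
    (hm : ∀ i, m i ∈ τ ∧ ∀ x ∈ τ, f i (m i) ≤ f i x) {k k' : I} (hk : k ∈ D) (hk' : k' ∈ D)
    (hne : k ≠ k') (hkk : m k = m k') :
    ∃! r, (IsRoom f r ∧ Incident r (τ, D)) ∧ EnteredAt f τ D k r := by
  have hcard : #D = #τ + 1 := hd.2
  have hiff : ∀ l x, (∃ z ∈ τ, f l z < f l x) ↔ f l (m l) < f l x := fun l x =>
    ⟨fun ⟨z, hz, h⟩ => ((hm l).2 z hz).trans_lt h, fun h => ⟨m l, (hm l).1, h⟩⟩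
  by_cases hM : ∃ y, ∀ l ∈ D.erase k, f l (m l) < f l y
  -- Maximality in `f k` keeps dominance after inserting `x`: points above the other minima are
  -- caught by `k`, all remaining ones by another order.
  · obtain ⟨x, hx, hmax⟩ := Set.exists_max_image {y | ∀ l ∈ D.erase k, f l (m l) < f l y} (f k)
      (Set.toFinite _) hM
    have hxτ : x ∉ τ := by
      intro hxτ
      obtain ⟨i, hi, hix⟩ := hd.1 x
      have hik : i = k := by
        by_contra h
        exact (hx i (mem_erase.2 ⟨h, hi⟩)).not_ge (hix _ (hm i).1)
      subst hik
      have : x = m i := hf i (le_antisymm (hix _ (hm i).1) ((hm i).2 x hxτ))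
      have h2 := hx k' (mem_erase.2 ⟨hne.symm, hk'⟩)
      rw [this, hkk] at h2
      exact h2.false
    have hxk : f k x ≤ f k (m k) := by
      obtain ⟨i, hi, hix⟩ := hd.1 x
      have hik : i = k := by
        by_contra h
        exact (hx i (mem_erase.2 ⟨h, hi⟩)).not_ge (hix _ (hm i).1)
      subst hik
      exact hix _ (hm i).1
    refine ⟨(insert x τ, D), ⟨⟨⟨fun y => ?_, ?_⟩, ?_, ?_⟩, ?_⟩, ?_⟩
    · by_cases hy : ∀ l ∈ D.erase k, f l (m l) < f l y
      · refine ⟨k, hk, fun z hz => ?_⟩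
        rcases mem_insert.1 hz with rfl | hz
        · exact hmax y hy
        · exact (hmax y hy).trans (hxk.trans ((hm k).2 z hz))
      · push Not at hy
        obtain ⟨l, hl, hly⟩ := hy
        refine ⟨l, (mem_erase.1 hl).2, fun z hz => ?_⟩
        rcases mem_insert.1 hz with rfl | hz
        · exact hly.trans (hx l hl).le
        · exact hly.trans ((hm l).2 z hz)
    · simp [card_insert_of_notMem hxτ, hcard]
    · exact subset_insert _ _
    · exact Subset.rfl
    · exact .inr ⟨x, hxτ, rfl, fun l hl => (hiff l x).2 (hx l hl)⟩
    · rintro r ⟨⟨hr, -⟩, rfl | ⟨x', hx'τ, rfl, hx'⟩⟩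
      · obtain ⟨i, hi, hix⟩ := hr.1 x
        exact absurd (hix _ (hm i).1) (hx i hi).not_ge
      · have hx'M : ∀ l ∈ D.erase k, f l (m l) < f l x' := fun l hl => (hiff l x').1 (hx' l hl)
        have h1 := hmax x' hx'M
        obtain ⟨i, hi, hix⟩ := hr.1 x
        have hik : i = k := by
          by_contra h
          exact (hx i (mem_erase.2 ⟨h, hi⟩)).not_ge (hix _ (mem_insert_of_mem (hm i).1))
        subst hik
        rw [hf i (le_antisymm h1 (hix _ (mem_insert_self _ _)))]
  · have hM' := hM
    push Not at hM'
    refine ⟨(τ, D.erase k), ⟨⟨⟨fun y => ?_, ?_⟩, Subset.rfl, erase_subset _ _⟩, .inl rfl⟩, ?_⟩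
    · obtain ⟨l, hl, hly⟩ := hM' y
      exact ⟨l, hl, fun z hz => hly.trans ((hm l).2 z hz)⟩
    · simp [card_erase_of_mem hk, hcard]
    · rintro r ⟨-, rfl | ⟨x', hx'τ, rfl, hx'⟩⟩
      · rfl
      · exact absurd ⟨x', fun l hl => (hiff l x').1 (hx' l hl)⟩ hM

/-- If a point `x` was added, `k` is the order whose minimum is now `x`; by bijectivity all other
orders keep their minima in `τ`, so these still cover `τ`. This makes `k` one of the two orders with
a common minimum. -/
theorem enteredAt_of_incident {f : I → T → α} (hf : ∀ i, Function.Injective (f i))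
    {τ : Finset T} {D : Finset I} (hd : IsDoor f (τ, D)) {m : I → T}
    (hm : ∀ i, m i ∈ τ ∧ ∀ x ∈ τ, f i (m i) ≤ f i x) {r : Finset T × Finset I}
    (hr : IsRoom f r) (h : Incident r (τ, D)) :
    ∃ k ∈ D, (D.erase k).image m = τ ∧ EnteredAt f τ D k r := by
  rcases incident_cases hr hd h with ⟨k, hk, rfl⟩ | ⟨x, hx, rfl⟩
  · exact ⟨k, hk, hr.1.image_minimizer hf hm, .inl rfl⟩
  · simp only at hx hr
    obtain ⟨m', hm'⟩ := exists_minimizer f (insert_nonempty x τ)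
    have him := hr.1.image_minimizer hf hm'
    simp only at him
    have hinj : Set.InjOn m' (D : Set I) := by
      rw [← card_image_iff, him]; exact hr.2
    obtain ⟨k, hk, hkx⟩ := mem_image.1 (him ▸ mem_insert_self x τ)
    have hτ' : ∀ l ∈ D.erase k, m' l ∈ τ := fun l hl => by
      rcases mem_insert.1 (hm' l).1 with h | h
      · exact absurd (hinj (mem_erase.1 hl).2 hk (h.trans hkx.symm)) (mem_erase.1 hl).1
      · exact h
    have hmm : ∀ l ∈ D.erase k, m' l = m l := fun l hl =>
      hf l (le_antisymm ((hm' l).2 _ (mem_insert_of_mem (hm l).1)) ((hm l).2 _ (hτ' l hl)))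
    refine ⟨k, hk, ?_, .inr ⟨x, hx, rfl, fun l hl => ⟨m' l, hτ' l hl, ?_⟩⟩⟩
    · rw [← image_congr (f := m') (fun l hl => hmm l hl)]
      apply Subset.antisymm
      · intro y hy
        obtain ⟨l, hl, rfl⟩ := mem_image.1 hy
        exact hτ' l hl
      · intro y hy
        obtain ⟨l, hl, hly⟩ := mem_image.1 (him ▸ mem_insert_of_mem hy : y ∈ D.image m')
        refine mem_image.2 ⟨l, mem_erase.2 ⟨?_, hl⟩, hly⟩
        rintro rfl
        exact hx (hkx ▸ hly ▸ hy)
    · refine lt_of_le_of_ne ((hm' l).2 x (mem_insert_self _ _)) fun he => hx ?_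
      rw [← hf l he]
      exact hτ' l hl

open Classical in
/-- A door with at least one point belongs to exactly two rooms. -/
theorem card_rooms_of_door [Fintype T] [Fintype I] {f : I → T → α}
    (hf : ∀ i, Function.Injective (f i)) {d : Finset T × Finset I} (hd : IsDoor f d)
    (hne : d.1.Nonempty) : #{r | IsRoom f r ∧ Incident r d} = 2 := by
  obtain ⟨τ, D⟩ := d
  obtain ⟨m, hm⟩ := exists_minimizer f hne
  obtain ⟨a, ha, b, hb, hab, hmab, hpair⟩ :=
    exists_pair_of_card_eq_succ hd.2 (hd.1.image_minimizer hf hm)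
  obtain ⟨ra, ⟨hra, hEa⟩, hua⟩ := existsUnique_enteredAt hf hd hm ha hb hab hmab
  obtain ⟨rb, ⟨hrb, hEb⟩, hub⟩ := existsUnique_enteredAt hf hd hm hb ha hab.symm hmab.symm
  rw [card_eq_two]
  refine ⟨ra, rb, ?_, ?_⟩
  · rintro rfl
    rcases hEa with rfl | ⟨x, hx, rfl, hxa⟩
    · rcases hEb with h | ⟨x, hx, h, -⟩
      · have h1 : D.erase a = D.erase b := (Prod.ext_iff.1 h).2
        have : b ∈ D.erase b := h1 ▸ mem_erase.2 ⟨hab.symm, hb⟩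
        exact (mem_erase.1 this).1 rfl
      · have h1 : τ = insert x τ := (Prod.ext_iff.1 h).1
        exact hx (h1 ▸ mem_insert_self x τ)
    · rcases hEb with h | ⟨x', hx', h, hxb⟩
      · have h1 : insert x τ = τ := (Prod.ext_iff.1 h).1
        exact hx (h1 ▸ mem_insert_self x τ)
      · have hxx : x = x' := by
          have h1 : insert x τ = insert x' τ := (Prod.ext_iff.1 h).1
          exact (mem_insert.1 (h1 ▸ mem_insert_self x τ : x ∈ insert x' τ)).resolve_right hx
        subst hxx
        -- As `a ≠ b`, every order in `D` differs from `a` or from `b`, so `x` would exceed some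
        -- point of `τ` in every order, against dominance of the door.
        obtain ⟨i, hi, hix⟩ := hd.1 x
        obtain ⟨z, hz, hlt⟩ : ∃ z ∈ τ, f i z < f i x := by
          by_cases h : i = a
          · exact hxb i (mem_erase.2 ⟨h ▸ hab, hi⟩)
          · exact hxa i (mem_erase.2 ⟨h, hi⟩)
        exact (hix z hz).not_gt hlt
  · ext r
    simp only [mem_filter, mem_univ, true_and, mem_insert, mem_singleton]
    constructor
    · rintro ⟨hr, hi⟩
      obtain ⟨k, hk, him, hE⟩ := enteredAt_of_incident hf hd hm hr hi
      rcases (hpair k hk).1 him with rfl | rfl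
      · exact .inl (hua r ⟨⟨hr, hi⟩, hE⟩)
      · exact .inr (hub r ⟨⟨hr, hi⟩, hE⟩)
    · rintro (rfl | rfl)
      exacts [hra, hrb]

/-- A door whose points carry all of its colours but `i₀`. -/
def IsColoredDoor (f : I → T → α) (c : T → I) (i₀ : I) (d : Finset T × Finset I) : Prop :=
  IsDoor f d ∧ i₀ ∈ d.2 ∧ d.1.image c = d.2.erase i₀

open Classical in
/-- The only coloured door without points belongs to exactly one room. -/
theorem card_rooms_of_empty_door [Fintype T] [Fintype I] [Nonempty T] {f : I → T → α}
    (hf : ∀ i, Function.Injective (f i)) (i : I) :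
    #{r : Finset T × Finset I | IsRoom f r ∧ Incident r (∅, {i})} = 1 := by
  obtain ⟨x, -, hx⟩ := exists_max_image univ (f i) univ_nonempty
  rw [card_eq_one]
  refine ⟨({x}, {i}), ?_⟩
  have hd : IsDoor f ((∅ : Finset T), {i}) := ⟨fun y => ⟨i, by simp⟩, by simp⟩
  ext r
  simp only [mem_filter, mem_univ, true_and, mem_singleton]
  constructor
  · rintro ⟨hr, hi⟩
    rcases incident_cases hr hd hi with ⟨k, hk, rfl⟩ | ⟨y, hy, rfl⟩
    · obtain ⟨j, hj, -⟩ := hr.1 x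
      simp_all
    · obtain ⟨j, hj, hjx⟩ := hr.1 x
      simp only [mem_singleton, insert_empty_eq, forall_eq] at hj hjx
      subst hj
      simp [hf j (le_antisymm hjx (hx y (mem_univ y)))]
  · rintro rfl
    exact ⟨⟨fun y => ⟨i, by simp, by simpa using hx y (mem_univ y)⟩, by simp⟩, by simp [Incident]⟩

theorem isColoredDoor_and_incident_iff {f : I → T → α} {c : T → I} {i₀ : I} {σ : Finset T}
    {C : Finset I} (hr : IsRoom f (σ, C)) {d : Finset T × Finset I} :
    IsColoredDoor f c i₀ d ∧ Incident (σ, C) d ↔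
      (i₀ ∈ C ∧ ∃ x ∈ σ, d = (σ.erase x, C) ∧ (σ.erase x).image c = C.erase i₀) ∨
      ∃ j ∉ C, d = (σ, insert j C) ∧ i₀ ∈ insert j C ∧ σ.image c = (insert j C).erase i₀ := by
  have hcard : #σ = #C := hr.2
  constructor
  · rintro ⟨⟨hd, hi, him⟩, hinc⟩
    obtain ⟨τ, D⟩ := d
    rcases incident_cases hr hd hinc with ⟨k, hk, h⟩ | ⟨x, hx, h⟩
    · obtain ⟨rfl, rfl⟩ := Prod.mk.injEq .. ▸ h
      refine .inr ⟨k, by simp, ?_⟩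
      simp only [insert_erase hk]
      exact ⟨trivial, hi, him⟩
    · obtain ⟨rfl, rfl⟩ := Prod.mk.injEq .. ▸ h
      refine .inl ⟨hi, x, by simp, ?_⟩
      simp only at hx
      simp only [erase_insert hx]
      exact ⟨trivial, him⟩
  · rintro (⟨hi, x, hx, rfl, him⟩ | ⟨j, hj, rfl, hi, him⟩)
    · refine ⟨⟨⟨hr.1.mono (erase_subset _ _) Subset.rfl, ?_⟩, hi, him⟩, erase_subset _ _, Subset.rfl⟩
      simp only [card_erase_of_mem hx]
      have := card_pos.2 ⟨x, hx⟩
      omega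
    · refine ⟨⟨⟨hr.1.mono Subset.rfl (subset_insert _ _), ?_⟩, hi, him⟩, Subset.rfl,
        subset_insert _ _⟩
      simp only [card_insert_of_notMem hj]
      omega

open Classical in
/-- A room that is not fully coloured has an even number of coloured doors. -/
theorem even_card_doors [Fintype T] [Fintype I] {f : I → T → α} {c : T → I} {i₀ : I}
    {r : Finset T × Finset I} (hr : IsRoom f r) (hne : r.1.image c ≠ r.2) :
    Even #{d | IsColoredDoor f c i₀ d ∧ Incident r d} := by
  obtain ⟨σ, C⟩ := r
  have hcard : #σ = #C := hr.2
  simp only at hne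
  simp only [isColoredDoor_and_incident_iff hr]
  by_cases hi : i₀ ∈ C
  · have hCi : #C = #(C.erase i₀) + 1 := (card_erase_add_one hi).symm
    -- Only the colour `i₀` is missing: the two doors drop one or the other of the two points of
    -- equal colour.
    by_cases hA : σ.image c = C.erase i₀
    · obtain ⟨a, ha, b, hb, hab, -, hpair⟩ := exists_pair_of_card_eq_succ (hcard.trans hCi) hA
      have : #{d : Finset T × Finset I | (i₀ ∈ C ∧ ∃ x ∈ σ, d = (σ.erase x, C) ∧
          (σ.erase x).image c = C.erase i₀) ∨ ∃ j ∉ C, d = (σ, insert j C) ∧ i₀ ∈ insert j C ∧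
            σ.image c = (insert j C).erase i₀} = 2 := by
        rw [card_eq_two]
        refine ⟨(σ.erase a, C), (σ.erase b, C), fun h => ?_, ?_⟩
        · have h1 : σ.erase a = σ.erase b := (Prod.ext_iff.1 h).1
          exact (mem_erase.1 (h1 ▸ mem_erase.2 ⟨hab.symm, hb⟩ : b ∈ σ.erase b)).1 rfl
        · ext d
          simp only [mem_filter, mem_univ, true_and, mem_insert, mem_singleton]
          constructor
          · rintro (⟨-, x, hx, rfl, him⟩ | ⟨j, hj, rfl, -, him⟩)
            · rcases (hpair x hx).1 him with rfl | rfl <;> simp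
            · have : j ∈ C.erase i₀ := by
                rw [← hA, him]
                exact mem_erase.2 ⟨fun h => hj (h ▸ hi), mem_insert_self _ _⟩
              exact absurd (mem_erase.1 this).2 hj
          · rintro (rfl | rfl)
            · exact .inl ⟨hi, a, ha, rfl, (hpair a ha).2 (.inl rfl)⟩
            · exact .inl ⟨hi, b, hb, rfl, (hpair b hb).2 (.inr rfl)⟩
      rw [this]
      exact even_two
    -- One foreign colour `j` replaces `i₀`: the two doors drop the point coloured `j` or add the
    -- order `j`.
    by_cases hB : ∃ j ∉ C, σ.image c = insert j (C.erase i₀)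
    · obtain ⟨j, hj, hB⟩ := hB
      have hji : j ≠ i₀ := fun h => hj (h ▸ hi)
      have hjC : j ∉ C.erase i₀ := fun h => hj (mem_erase.1 h).2
      have hinj : Set.InjOn c (σ : Set T) := by
        rw [← card_image_iff, hB, card_insert_of_notMem hjC]
        omega
      obtain ⟨x₀, hx₀, hc⟩ := mem_image.1 (hB ▸ mem_insert_self j _ : j ∈ σ.image c)
      have : #{d : Finset T × Finset I | (i₀ ∈ C ∧ ∃ x ∈ σ, d = (σ.erase x, C) ∧
          (σ.erase x).image c = C.erase i₀) ∨ ∃ j ∉ C, d = (σ, insert j C) ∧ i₀ ∈ insert j C ∧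
            σ.image c = (insert j C).erase i₀} = 2 := by
        rw [card_eq_two]
        refine ⟨(σ.erase x₀, C), (σ, insert j C), fun h => ?_, ?_⟩
        · have h1 : C = insert j C := (Prod.ext_iff.1 h).2
          exact hj (h1 ▸ mem_insert_self j C)
        · ext d
          simp only [mem_filter, mem_univ, true_and, mem_insert, mem_singleton]
          constructor
          · rintro (⟨-, x, hx, rfl, him⟩ | ⟨j', hj', rfl, -, him⟩)
            · left
              by_cases hxx : x₀ = x
              · rw [hxx]
              · exact absurd (him ▸ mem_image.2 ⟨x₀, mem_erase.2 ⟨hxx, hx₀⟩, hc⟩) hjC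
            · right
              have : j ∈ (insert j' C).erase i₀ := by
                rw [← him, hB]
                exact mem_insert_self _ _
              rcases mem_insert.1 (mem_erase.1 this).2 with rfl | h
              · rfl
              · exact absurd h hj
          · rintro (rfl | rfl)
            · refine .inl ⟨hi, x₀, hx₀, rfl, ?_⟩
              rw [← erase_insert hjC, ← hB, ← hc]
              ext y
              simp only [mem_image, mem_erase]
              constructor
              · rintro ⟨z, ⟨hz, hzσ⟩, rfl⟩
                exact ⟨fun h => hz (hinj hzσ hx₀ h), z, hzσ, rfl⟩
              · rintro ⟨hy, z, hz, rfl⟩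
                exact ⟨z, ⟨fun h => hy (h ▸ rfl), hz⟩, rfl⟩
            · refine .inr ⟨j, hj, rfl, .inr hi, ?_⟩
              rw [hB, erase_insert_of_ne hji]
      rw [this]
      exact even_two
    · rw [filter_eq_empty_iff.2, card_empty]
      · exact Even.zero
      rintro d - (⟨-, x, hx, rfl, him⟩ | ⟨j, hj, rfl, -, him⟩)
      · have h1 : σ.image c = insert (c x) (C.erase i₀) := by
          rw [← him, ← image_insert, insert_erase hx]
        by_cases hxi : c x = i₀
        · exact hne (by rw [h1, hxi, insert_erase hi])
        by_cases hxC : c x ∈ C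
        · exact hA (by rw [h1, insert_eq_of_mem (mem_erase.2 ⟨hxi, hxC⟩)])
        · exact hB ⟨c x, hxC, h1⟩
      · exact hB ⟨j, hj, by rw [him, erase_insert_of_ne fun h : j = i₀ => hj (h ▸ hi)]⟩
  · rw [filter_eq_empty_iff.2, card_empty]
    · exact Even.zero
    rintro d - (⟨h, -⟩ | ⟨j, hj, rfl, hij, him⟩)
    · exact hi h
    · obtain rfl : i₀ = j := (mem_insert.1 hij).resolve_right hi
      exact hne (by rw [him, erase_insert hj])

open Classical in
/-- **Scarf's lemma**. -/
theorem exists_dominant_image_eq [Finite T] [Finite I] [Nonempty T] [Nonempty I] {f : I → T → α}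
    (hf : ∀ i, Function.Injective (f i)) (c : T → I) :
    ∃ σ : Finset T, ∃ C : Finset I, Dominant f σ C ∧ #σ = #C ∧ σ.image c = C := by
  have := Fintype.ofFinite T
  have := Fintype.ofFinite I
  obtain ⟨i₀⟩ := ‹Nonempty I›
  by_contra! hcon
  have key := sum_card_bipartiteAbove_eq_sum_card_bipartiteBelow
    (s := ({r | IsRoom f r} : Finset (Finset T × Finset I)))
    (t := ({d | IsColoredDoor f c i₀ d} : Finset (Finset T × Finset I))) Incident
  have h1 : Even (∑ r ∈ ({r | IsRoom f r} : Finset (Finset T × Finset I)),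
      #(bipartiteAbove Incident
        ({d | IsColoredDoor f c i₀ d} : Finset (Finset T × Finset I)) r)) := by
    refine even_sum _ fun r hr => ?_
    have hr' : IsRoom f r := by simpa using hr
    have := even_card_doors (i₀ := i₀) hr' (hcon r.1 r.2 hr'.1 hr'.2)
    simpa only [bipartiteAbove, filter_filter] using this
  rw [key] at h1
  have hmem : ((∅ : Finset T), ({i₀} : Finset I)) ∈
      ({d | IsColoredDoor f c i₀ d} : Finset (Finset T × Finset I)) := by
    rw [mem_filter]
    simp [IsColoredDoor, IsDoor, Dominant]
  rw [← add_sum_erase _ _ hmem] at h1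
  have h2 : Even (∑ d ∈ ({d | IsColoredDoor f c i₀ d} : Finset (Finset T × Finset I)).erase
      (∅, {i₀}), #(bipartiteBelow Incident
        ({r | IsRoom f r} : Finset (Finset T × Finset I)) d)) := by
    refine even_sum _ fun d hd => ?_
    obtain ⟨hd0, hd⟩ := mem_erase.1 hd
    have hd' : IsColoredDoor f c i₀ d := by simpa using hd
    have hne : d.1.Nonempty := by
      by_contra h
      rw [not_nonempty_iff_eq_empty] at h
      apply hd0
      have h3 := hd'.2.2
      rw [h, image_empty, eq_comm, erase_eq_empty_iff] at h3
      refine Prod.ext h (h3.resolve_left ?_)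
      exact ne_empty_of_mem hd'.2.1
    have := card_rooms_of_door hf hd'.1 hne
    simp only [bipartiteBelow, filter_filter, this, even_two]
  have h3 := card_rooms_of_empty_door hf i₀
  simp only [bipartiteBelow, filter_filter, h3] at h1 h2
  exact Nat.not_even_one ((Nat.even_add.1 h1).2 h2)

end Scarf

namespace CakeCutting

open Finset

/-! ### Scarf's lemma on a net of the simplex -/

/-- Points of a fine net of the simplex, close to each other, one for each colour of a nonempty set
`C` of colours, where the coordinates outside `C` are small. -/
theorem exists_close_points {n : ℕ} (hn : 0 < n) (c : CutSet n → Fin n) {ε : ℝ} (hε : 0 < ε) :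
    ∃ C : Finset (Fin n), C.Nonempty ∧ ∃ p : Fin n → CutSet n,
      (∀ i ∈ C, c (p i) = i) ∧ (∀ i ∈ C, ∀ j ∈ C, dist (p i) (p j) < ε) ∧
      ∀ i ∈ C, ∀ j ∉ C, p i j < ε := by
  have : Nonempty (Fin n) := ⟨⟨0, hn⟩⟩
  have hn' : (0 : ℝ) < n := by exact_mod_cast hn
  obtain ⟨t, -, htfin, ht⟩ := finite_cover_balls_of_compact
    (isCompact_univ : IsCompact (Set.univ : Set (CutSet n))) (div_pos hε hn')
  have hnet : ∀ y : CutSet n, ∃ z : t, dist y z < ε / n := fun y => by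
    have := ht (Set.mem_univ y)
    simp only [Set.mem_iUnion, Metric.mem_ball] at this
    obtain ⟨z, hz, h⟩ := this
    exact ⟨⟨z, hz⟩, h⟩
  have : Finite t := htfin
  obtain ⟨z₀, -⟩ := hnet (stdSimplex.vertex ⟨0, hn⟩)
  have : Nonempty t := ⟨z₀⟩
  obtain ⟨N, ⟨e⟩⟩ := Finite.exists_equiv_fin t
  -- The enumeration `e` breaks ties between equal coordinates, which makes the orders injective.
  let f : Fin n → t → ℝ ×ₗ Fin N := fun i z => toLex ((z : CutSet n) i, e z)
  have hf : ∀ i, Function.Injective (f i) := fun i a b h => by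
    have h1 := congrArg (fun q => (ofLex q).2) h
    exact e.injective h1
  have hfle : ∀ {i a b}, f i a ≤ f i b → (a : CutSet n) i ≤ (b : CutSet n) i := fun {i a b} h => by
    rcases Prod.Lex.toLex_le_toLex.1 h with h | h
    exacts [h.le, h.1.le]
  classical
  obtain ⟨σ, C, hdom, hcard, him⟩ := Scarf.exists_dominant_image_eq hf (fun z : t => c z)
  have hC : C.Nonempty := by
    obtain ⟨i, hi, -⟩ := hdom z₀
    exact ⟨i, hi⟩
  have hσ : σ.Nonempty := by
    rw [← card_pos, hcard]
    exact card_pos.2 hC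
  choose m hmσ hm using fun i : Fin n => exists_min_image σ (fun z : t => (z : CutSet n) i) hσ
  set S : ℝ := ∑ i ∈ C, (m i : CutSet n) i with hS
  have hC' : (0 : ℝ) < #C := by exact_mod_cast card_pos.2 hC
  have hS1 : S ≤ 1 := by
    obtain ⟨z, hz⟩ := hσ
    calc S ≤ ∑ i ∈ C, (z : CutSet n) i := sum_le_sum fun i _ => hm i z hz
      _ ≤ ∑ i, (z : CutSet n) i :=
        sum_le_sum_of_subset_of_nonneg (subset_univ _) fun i _ _ => (z : CutSet n).2.1 i
      _ = 1 := (z : CutSet n).2.2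
  have hdefect : 1 - S < ε := by
    -- The defect `1 - S` is shared equally among the minima in `C`. Dominance stops a net point
    -- near `y` from exceeding all of them, so each share is below the net radius `ε / n`; there are
    -- at most `n` shares.
    let y : CutSet n := ⟨fun i => if i ∈ C then (m i : CutSet n) i + (1 - S) / #C else 0, by
      refine ⟨fun i => ?_, ?_⟩
      · dsimp only
        split_ifs
        · have := (m i : CutSet n).2.1 i
          have : 0 ≤ (1 - S) / #C := div_nonneg (by linarith) hC'.le
          exact add_nonneg ‹_› ‹_›
        · exact le_rfl
      · rw [sum_ite_mem, univ_inter, sum_add_distrib, sum_const, nsmul_eq_mul,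
          mul_div_cancel₀ _ hC'.ne', ← hS]
        ring⟩
    obtain ⟨z, hz⟩ := hnet y
    obtain ⟨i, hi, hiz⟩ := hdom z
    have h1 := hfle (hiz _ (hmσ i))
    have h2 : dist (y i) ((z : CutSet n) i) < ε / n :=
      (dist_le_pi_dist (y : Fin n → ℝ) (z : CutSet n) i).trans_lt hz
    have h3 : y i = (m i : CutSet n) i + (1 - S) / #C := if_pos hi
    rw [h3, Real.dist_eq] at h2
    have h4 : (1 - S) / #C < ε / n := by linarith [(abs_lt.1 h2).2]
    have h5 : (#C : ℝ) ≤ n := by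
      exact_mod_cast (card_le_univ C).trans_eq (Fintype.card_fin n)
    rw [div_lt_div_iff₀ hC' hn'] at h4
    exact lt_of_mul_lt_mul_right (h4.trans_le (mul_le_mul_of_nonneg_left h5 hε.le)) hn'.le
  -- All terms are nonnegative and their total is below `ε`, so each single term is below `ε`.
  have hsplit : ∀ z ∈ σ, ∑ i ∈ C, ((z : CutSet n) i - (m i : CutSet n) i) +
      ∑ i ∈ Cᶜ, (z : CutSet n) i = 1 - S := fun z _ => by
    have h := sum_add_sum_compl C (fun i => (z : CutSet n) i)
    have h1 : ∑ i, (z : CutSet n) i = 1 := (z : CutSet n).2.2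
    rw [sum_sub_distrib, ← hS]
    linarith
  have hin : ∀ z ∈ σ, ∀ i ∈ C, (z : CutSet n) i < (m i : CutSet n) i + ε := fun z hz i hi => by
    have h1 := single_le_sum (f := fun i => (z : CutSet n) i - (m i : CutSet n) i)
      (fun j _ => sub_nonneg.2 (hm j z hz)) hi
    have h2 : 0 ≤ ∑ i ∈ Cᶜ, (z : CutSet n) i := sum_nonneg fun i _ => (z : CutSet n).2.1 i
    have h3 := hsplit z hz
    linarith
  have hout : ∀ z ∈ σ, ∀ i ∉ C, (z : CutSet n) i < ε := fun z hz i hi => by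
    have h1 := single_le_sum (f := fun i => (z : CutSet n) i)
      (fun j _ => (z : CutSet n).2.1 j) (mem_compl.2 hi)
    have h2 : 0 ≤ ∑ i ∈ C, ((z : CutSet n) i - (m i : CutSet n) i) :=
      sum_nonneg fun j _ => sub_nonneg.2 (hm j z hz)
    have h3 := hsplit z hz
    linarith
  have hp : ∀ i, ∃ z ∈ σ, i ∈ C → c z = i := fun i => by
    by_cases hi : i ∈ C
    · rw [← him] at hi
      obtain ⟨z, hz, hzi⟩ := mem_image.1 hi
      exact ⟨z, hz, fun _ => hzi⟩
    · obtain ⟨z, hz⟩ := hσ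
      exact ⟨z, hz, fun h => absurd h hi⟩
  choose p hpσ hpc using hp
  refine ⟨C, hC, fun i => p i, hpc, fun i _ j _ => ?_, fun i _ j hj => hout _ (hpσ i) j hj⟩
  rw [Subtype.dist_eq, dist_pi_lt_iff hε]
  intro k
  rw [Real.dist_eq, abs_lt]
  by_cases hk : k ∈ C
  · have h1 := hin _ (hpσ i) k hk
    have h2 := hin _ (hpσ j) k hk
    have h3 := hm k _ (hpσ i)
    have h4 := hm k _ (hpσ j)
    change -ε < (p i : CutSet n) k - (p j : CutSet n) k ∧
      (p i : CutSet n) k - (p j : CutSet n) k < ε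
    constructor <;> linarith
  · have h1 := hout _ (hpσ i) k hk
    have h2 := hout _ (hpσ j) k hk
    have h3 := (p i : CutSet n).2.1 k
    have h4 := (p j : CutSet n).2.1 k
    change 0 ≤ (p i : CutSet n) k at h3
    change 0 ≤ (p j : CutSet n) k at h4
    change -ε < (p i : CutSet n) k - (p j : CutSet n) k ∧
      (p i : CutSet n) k - (p j : CutSet n) k < ε
    constructor <;> linarith

/-! ### From approximate to exact equitable divisions -/

/-- An agent has a small value for a small piece. -/
theorem Instance.exists_forall_val_lt {n : ℕ} (I : Instance n) (i : Fin n) {δ : ℝ} (hδ : 0 < δ) :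
    ∃ ε > 0, ∀ x : CutSet n, x i < ε → I.val i x < δ := by
  have hcont : Continuous fun x : CutSet n => x i :=
    (continuous_apply i).comp continuous_subtype_val
  have hK : IsCompact {x : CutSet n | δ ≤ I.val i x} :=
    (isClosed_le continuous_const (I.continuous_val i)).isCompact
  rcases Set.eq_empty_or_nonempty {x : CutSet n | δ ≤ I.val i x} with h | h
  · exact ⟨1, one_pos, fun x _ => not_le.1 fun hx => (h ▸ hx : x ∈ (∅ : Set (CutSet n)))⟩
  -- The least length of piece `i` over the compact set of cut-sets of value at least `δ` serves as
  -- `ε`; it is positive because an empty piece has value 0.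
  · obtain ⟨x₀, hx₀, hmin⟩ := hK.exists_isMinOn h hcont.continuousOn
    refine ⟨x₀ i, lt_of_le_of_ne (x₀.2.1 i) fun h0 => ?_, fun x hx => not_le.1 fun hxδ =>
      (hmin hxδ).not_gt hx⟩
    have h1 : δ ≤ I.val i x₀ := hx₀
    rw [I.val_eq_zero i x₀ h0.symm] at h1
    exact hδ.not_ge h1

/-- Agents in `C` are compared through a nearby point where they have the least value, which costs
`δ` for each of the two values moved. Agents outside `C` have value below `δ`, and nonnegativity
bounds the other side. -/
theorem Instance.exists_approx_equitable {n : ℕ} (hn : 0 < n) (I : Instance n) (hI : I.Nonneg)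
    {δ : ℝ} (hδ : 0 < δ) : ∃ x : CutSet n, ∀ i j, I.val i x ≤ I.val j x + 2 * δ := by
  have : Nonempty (Fin n) := ⟨⟨0, hn⟩⟩
  have hunif : ∃ ε > 0, ∀ i, ∀ x y : CutSet n, dist x y < ε → dist (I.val i x) (I.val i y) < δ := by
    have h : UniformContinuous fun x i => I.val i x :=
      CompactSpace.uniformContinuous_of_continuous (continuous_pi I.continuous_val)
    obtain ⟨ε, hε, h⟩ := Metric.uniformContinuous_iff.1 h δ hδ
    exact ⟨ε, hε, fun i x y hxy => (dist_le_pi_dist _ _ i).trans_lt (h hxy)⟩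
  obtain ⟨ε₁, hε₁, hu⟩ := hunif
  choose η hη hsmall using fun i => I.exists_forall_val_lt i hδ
  choose c hc using fun x : CutSet n => Finite.exists_min (fun i => I.val i x)
  obtain ⟨k₀, hk₀⟩ := Finite.exists_min η
  obtain ⟨C, ⟨k, hk⟩, p, hpc, hclose, hout⟩ :=
    exists_close_points hn c (lt_min hε₁ (hη k₀))
  refine ⟨p k, fun i j => ?_⟩
  by_cases hi : i ∈ C
  · have hd := (hclose k hk i hi).trans_le (min_le_left _ _)
    have h1 := hu i _ _ hd
    have h2 := hu j _ _ hd
    have h3 := hc (p i) j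
    rw [hpc i hi] at h3
    rw [Real.dist_eq] at h1 h2
    have h4 := (abs_lt.1 h1).2
    have h5 := (abs_lt.1 h2).1
    linarith
  · have h1 := hsmall i (p k) (((hout k hk i hi).trans_le (min_le_right _ _)).trans_le (hk₀ i))
    have h2 := hI j (p k)
    linarith

theorem Instance.exists_isEquitable {n : ℕ} (hn : 0 < n) (I : Instance n) (hI : I.Nonneg) :
    ∃ x : CutSet n, I.IsEquitable x := by
  choose x hx using fun k : ℕ => I.exists_approx_equitable hn hI (Nat.one_div_pos_of_nat (n := k))
  obtain ⟨a, -, φ, hφ, ha⟩ := isCompact_univ.tendsto_subseq fun k => Set.mem_univ (x k)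
  have hle : ∀ i j, I.val i a ≤ I.val j a := fun i j => by
    have h0 : Filter.Tendsto (fun k => 2 * (1 / ((φ k : ℝ) + 1))) Filter.atTop (nhds 0) := by
      simpa using (tendsto_one_div_add_atTop_nhds_zero_nat.comp hφ.tendsto_atTop).const_mul (2 : ℝ)
    have h1 := ((I.continuous_val i).tendsto a).comp ha
    have h2 := (((I.continuous_val j).tendsto a).comp ha).add h0
    rw [add_zero] at h2
    exact le_of_tendsto_of_tendsto' h1 h2 fun k => hx (φ k) i j
  exact ⟨a, fun i j => le_antisymm (hle i j) (hle j i)⟩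

/-! ### Prescribed orders and local valuations -/

/-- The connected division with the given order and the given shares of the agents. -/
def ConnectedDivision.ofShares {n : ℕ} (σ : Equiv.Perm (Fin n)) (x : CutSet n) :
    ConnectedDivision n :=
  ⟨σ, ⟨fun k => x (σ k), fun k => x.2.1 (σ k), (Equiv.sum_comp σ fun i => x i).trans x.2.2⟩⟩

theorem ConnectedDivision.shares_ofShares {n : ℕ} (σ : Equiv.Perm (Fin n)) (x : CutSet n) :
    (ofShares σ x).shares = x := by
  ext i
  exact congrArg x (σ.apply_symm_apply i)

/-- The instance in which the pieces are given out in the order `σ`. -/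
def GlobalProfile.toInstance {n : ℕ} (P : GlobalProfile n) (σ : Equiv.Perm (Fin n)) :
    Instance n where
  val i x := P.val i (.ofShares σ x)
  continuous_val i := by
    have hcut : Continuous fun x : CutSet n => (ConnectedDivision.ofShares σ x).cut :=
      Continuous.subtype_mk (continuous_pi fun k =>
        (continuous_apply (σ k)).comp (continuous_subtype_val (p := (· ∈ stdSimplex ℝ (Fin n))))) _
    exact (P.continuous_val i σ).comp hcut
  val_eq_zero i x hx := P.val_eq_zero i _ (by rwa [ConnectedDivision.shares_ofShares])

/-- Indexing lengths by agents instead of positions absorbs the order into the valuations, so the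
case of the identity order suffices. -/
theorem GlobalProfile.exists_isEquitable {n : ℕ} (hn : 0 < n) (P : GlobalProfile n)
    (hP : P.Nonneg) (σ : Equiv.Perm (Fin n)) :
    ∃ D : ConnectedDivision n, D.order = σ ∧ P.IsEquitable D := by
  obtain ⟨x, hx⟩ := (P.toInstance σ).exists_isEquitable hn fun i x => hP i _
  exact ⟨.ofShares σ x, rfl, hx⟩

theorem ConnectedDivision.endpoints_mem_intervals {n : ℕ} (D : ConnectedDivision n) (i : Fin n) :
    (D.left i, D.right i) ∈ intervals := by
  refine ⟨sum_nonneg fun j _ => D.cut.2.1 j, le_add_of_nonneg_left (D.cut.2.1 _), ?_⟩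
  have h : D.right i = ∑ j ∈ insert (D.order.symm i) (Iio (D.order.symm i)), D.cut j := by
    rw [sum_insert (by simp)]
    rfl
  rw [h, ← D.cut.2.2]
  exact sum_le_sum_of_subset_of_nonneg (subset_univ _) fun j _ _ => D.cut.2.1 j

/-- Local valuations, seen as global ones. -/
def LocalProfile.toGlobalProfile {n : ℕ} (L : LocalProfile n) : GlobalProfile n where
  val i D := L.val i (D.left i, D.right i)
  continuous_val i σ := by
    have hx : ∀ j, Continuous fun x : CutSet n => x j := fun j =>
      (continuous_apply j).comp continuous_subtype_val
    have hl : Continuous fun x : CutSet n => leftEnd x (σ.symm i) :=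
      continuous_finsetSum _ fun j _ => hx j
    have hr : Continuous fun x : CutSet n => rightEnd x (σ.symm i) :=
      (hx _).add (continuous_finsetSum _ fun j _ => hx j)
    exact (L.continuousOn_val i).comp_continuous (hl.prodMk hr) fun x =>
      ConnectedDivision.endpoints_mem_intervals ⟨σ, x⟩ i
  val_eq_zero i D hD := by
    have h0 : D.right i = D.left i := by
      have h : D.cut (D.order.symm i) = 0 := hD
      simp [ConnectedDivision.right, ConnectedDivision.left, rightEnd, leftEnd, h]
    have hmem := D.endpoints_mem_intervals i
    rw [h0] at hmem ⊢
    exact L.val_eq_zero i _ ⟨hmem.1, hmem.2.2⟩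

end CakeCutting

/-- Existence of connected equitable divisions for nonnegative valuations: for every instance with
global valuations, and for every order in which the pieces are given to the agents, where the
valuations are global ones of the agents' shares, global ones of arbitrary connected divisions, or
local ones. -/
theorem mainTheorem2 (n : ℕ) (hn : 0 < n) :
    (∀ I : CakeCutting.Instance n, I.Nonneg → ∃ x : CakeCutting.CutSet n, I.IsEquitable x) ∧
    (∀ I : CakeCutting.Instance n, I.Nonneg → ∀ σ : Equiv.Perm (Fin n),
      ∃ D : CakeCutting.ConnectedDivision n, D.order = σ ∧ I.IsEquitable D.shares) ∧
    (∀ P : CakeCutting.GlobalProfile n, P.Nonneg → ∀ σ : Equiv.Perm (Fin n),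
      ∃ D : CakeCutting.ConnectedDivision n, D.order = σ ∧ P.IsEquitable D) ∧
    (∀ L : CakeCutting.LocalProfile n, L.Nonneg → ∀ σ : Equiv.Perm (Fin n),
      ∃ D : CakeCutting.ConnectedDivision n, D.order = σ ∧ L.IsEquitable D) := by
  refine ⟨fun I hI => I.exists_isEquitable hn hI, fun I hI σ => ?_,
    fun P hP σ => P.exists_isEquitable hn hP σ,
    fun L hL σ => L.toGlobalProfile.exists_isEquitable hn
      (fun i D => hL i _ (D.endpoints_mem_intervals i)) σ⟩
  obtain ⟨x, hx⟩ := I.exists_isEquitable hn hI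
  exact ⟨.ofShares σ x, rfl, by rwa [CakeCutting.ConnectedDivision.shares_ofShares]⟩
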